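/- **Notation.** Write $z=(x,t)\in\mathbb R^2\times\mathbb R$, $\mathbf e_2=(0,1)$, and let $|\cdot|$ be the Euclidean length. Fix $0<\varepsilon_0<1$ and a real phase $\phi(z,\eta)$, smooth for $z\in B(0,\varepsilon_0)\subset\mathbb R^3$ and $\eta$ in the open cone generated by $B(\mathbf e_2,\varepsilon_0)\subset\mathbb R^2$, homogeneous of degree $1$ in $\eta$, such that for each $z\in B(0,\varepsilon_0)$ the map $\Upsilon_z:\eta\mapsto\partial_x\phi(z,\eta)$ is injective with invertible differential on $B(\mathbf e_2,\varepsilon_0)$; let $\Psi_z$ be its inverse, defined on $\Upsilon_z(B(\mathbf e_2,\varepsilon_0))$. Let $a_2\in C_c^\infty(B(\mathbf e_2,\varepsilon_0))$, and let $\rho\in C_c^\infty(\mathbb R^2)$ satisfy $\sum_{j\in\mathbb Z^2}\rho(\eta-j)\equiv1$. For $\lambda\ge1$ put $\phi^\lambda(z,\eta)=\lambda\phi(z/\lambda,\eta)$ and $\Psi^\lambda(z,\eta)=\Psi_{z/\lambda}(\eta)$. Let $\{\chi_\nu\}_{0\le\nu\le n}$, with $K^{-1}\lambda^{1/2}\le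 n\le K\lambda^{1/2}$, be functions on $\mathbb R^2\setminus0$ that are smooth, homogeneous of degree $0$, satisfy $\sum_\nu\chi_\nu\equiv1$ and $|\partial^\alpha\chi_\nu|\le C_{|\alpha|}\lambda^{|\alpha|/2}$ on the unit circle, and are such that for $\nu\ge1$ the function $\chi_\nu$ is supported where $\bigl|\eta/|\eta|-\kappa_\nu\bigr|\le K\lambda^{-1/2}$ for some unit vector $\kappa_\nu$. Let $\varepsilon>0$. For $\bar z$ with $\bar z/\lambda\in B(0,\varepsilon_0)$ (for example the centre $z_k$ of a cube $Q_k$ of side $\lambda^{1/2-\varepsilon}$), put $$h_{\bar z}(\eta)=(\partial_t\phi^\lambda)(\bar z,\Psi^\lambda(\bar z,\eta)),\qquad a^\nu_{2,\bar z}(\eta)=(\chi_\nu a_2)(\Psi^\lambda(\bar z,\eta))\,|\det\partial_\eta\Psi^\lambda(\bar z,\eta)|$$ (extended by $0$ off the domain of $\Psi^\lambda(\bar z,\cdot)$), and $$E^\nu_{\bar z}g(z)=\int_{\mathbb R^2}e^{i(\langle x,\eta\rangle+th_{\bar z}(\eta))}a^\nu_{2,\bar z}(\eta)g(\eta)\,d\eta,$$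 $$E^{\nu,j}_{\bar z}g(z)=\int_{\mathbb R^2}e^{i(\langle x,\eta\rangle+th_{\bar z}(\eta))}\rho(\lambda^{1/2-\varepsilon/2}\eta-j)\,a^\nu_{2,\bar z}(\eta)g(\eta)\,d\eta .$$ Let $N\in\mathbb N$, $A\ge1$, and let $w_{Q_0}$ be any measurable weight adapted to the cube $Q_0$ of side $\lambda^{1/2-\varepsilon}$ centred at the origin, in the sense that $$A^{-1}\Bigl(1+\frac{|z|}{\lambda^{1/2-\varepsilon}}\Bigr)^{-N}\le w_{Q_0}(z)\le A\Bigl(1+\frac{|z|}{\lambda^{1/2-\varepsilon}}\Bigr)^{-N}.$$ **Lemma.** There are a constant $C$ and a function $\mathrm{RapDec}:[1,\infty)\to[0,\infty)$ with $\mathrm{RapDec}(\lambda)=O_M(\lambda^{-M})$ for every $M$, depending only on $\varepsilon_0,\phi,a_2,\rho,K,(C_m)_m,N,A,\varepsilon$, such that for all $\lambda\ge1$, all $\{\chi_\nu\}$, $\bar z$, $w_{Q_0}$ as above and all $g\in L^{10/3}(\mathbb R^2)$, $$\Bigl\|\Bigl(\sum_{\nu}\sum_{j\in\mathbb Z^2}|E^{\nu,j}_{\bar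 z}g|^2\Bigr)^{1/2}\Bigr\|_{L^{10/3}(w_{Q_0})}\le C\lambda^{\frac{3N}{20}\varepsilon}\Bigl\|\Bigl(\sum_{\nu}|E^{\nu}_{\bar z}g|^2\Bigr)^{1/2}\Bigr\|_{L^{10/3}(w_{Q_0})}+\mathrm{RapDec}(\lambda)\|g\|_{L^{10/3}(\mathbb R^2)} .$$ In particular, for fixed $N$ the loss is $\lambda^{O_N(\varepsilon)}$, hence at most $\lambda^\delta$ for any prescribed $\delta>0$ once $\varepsilon$ is small. -/

import Mathlib

open MeasureTheory Set
open scoped ENNReal ContDiff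

noncomputable section

namespace RadialBlocks

/-- The plane `ℝ²` with its Euclidean norm. -/
abbrev Plane : Type := EuclideanSpace ℝ (Fin 2)

/-- Space-time `ℝ^{2+1}`, with points `z = (x, t)` and Lebesgue measure. The Euclidean length of
a point is `stNorm`, not the (supremum) norm of the product type. -/
abbrev SpaceTime : Type := Plane × ℝ

/-- The Euclidean length `|z| = (|x|² + t²)^{1/2}` of `z = (x, t)`. -/
def stNorm (z : SpaceTime) : ℝ := Real.sqrt (‖z.1‖ ^ 2 + z.2 ^ 2)

/-- The open Euclidean ball `B(0, r)` in `ℝ^{2+1}`. -/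
def stBall (r : ℝ) : Set SpaceTime := {z | stNorm z < r}

/-- The unit vector `e₂ = (0, 1)`. -/
def e₂ : Plane := !₂[0, 1]

/-- The open cone `{s η : s > 0, η ∈ B(e₂, ε₀)}`. -/
def coneOver (ε₀ : ℝ) : Set Plane :=
  {ξ | ∃ s : ℝ, 0 < s ∧ ∃ η ∈ Metric.ball e₂ ε₀, ξ = s • η}

/-! ### The phase -/

/-- `∂ₓ φ(z, η)`. -/
def gradX (φ : SpaceTime → Plane → ℝ) (z : SpaceTime) (η : Plane) : Plane :=
  gradient (fun x : Plane => φ (x, z.2) η) z.1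

/-- `∂ₜ φ(z, η)`. -/
def derivT (φ : SpaceTime → Plane → ℝ) (z : SpaceTime) (η : Plane) : ℝ :=
  deriv (fun t : ℝ => φ (z.1, t) η) z.2

/-- A smooth phase on `B(0, ε₀) × cone(B(e₂, ε₀))`, homogeneous of degree one in `η`, with `ε₀`
so small that for each `z ∈ B(0, ε₀)` the map `Υ_z : η ↦ ∂ₓφ(z, η)` is a diffeomorphism of
`B(e₂, ε₀)` onto its image. -/
structure IsPhase (φ : SpaceTime → Plane → ℝ) (ε₀ : ℝ) : Prop where
  smooth : ContDiffOn ℝ ∞ (fun p : SpaceTime × Plane => φ p.1 p.2) (stBall ε₀ ×ˢ coneOver ε₀)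
  homogeneous : ∀ z ∈ stBall ε₀, ∀ η ∈ coneOver ε₀, ∀ s : ℝ, 0 < s → φ z (s • η) = s * φ z η
  injOn : ∀ z ∈ stBall ε₀, InjOn (gradX φ z) (Metric.ball e₂ ε₀)
  det_ne_zero : ∀ z ∈ stBall ε₀, ∀ η ∈ Metric.ball e₂ ε₀, (fderiv ℝ (gradX φ z) η).det ≠ 0

/-- The image `Υ_z(B(e₂, ε₀))`, on which the inverse map `Ψ_z` lives. -/
def gradImage (φ : SpaceTime → Plane → ℝ) (ε₀ : ℝ) (z : SpaceTime) : Set Plane :=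
  gradX φ z '' Metric.ball e₂ ε₀

/-- `Ψ_z`, the inverse of `Υ_z = ∂ₓφ(z, ·)` on `B(e₂, ε₀)`; only its values on `gradImage φ ε₀ z`
are meaningful. -/
def psi (φ : SpaceTime → Plane → ℝ) (ε₀ : ℝ) (z : SpaceTime) : Plane → Plane :=
  Function.invFunOn (gradX φ z) (Metric.ball e₂ ε₀)

/-- The rescaled phase `φ^lam(z, η) = lam φ(z / lam, η)`. -/
def phaseScaled (φ : SpaceTime → Plane → ℝ) (lam : ℝ) (z : SpaceTime) (η : Plane) : ℝ :=
  lam * φ (lam⁻¹ • z) η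

/-- `Ψ^lam(z, η) = Ψ(z / lam, η)`. -/
def psiScaled (φ : SpaceTime → Plane → ℝ) (ε₀ lam : ℝ) (z : SpaceTime) : Plane → Plane :=
  psi φ ε₀ (lam⁻¹ • z)

/-- `h_z(η) = (∂ₜ φ^lam)(z, Ψ^lam(z, η))`. -/
def hFun (φ : SpaceTime → Plane → ℝ) (ε₀ lam : ℝ) (z : SpaceTime) (η : Plane) : ℝ :=
  derivT (phaseScaled φ lam) z (psiScaled φ ε₀ lam z η)

open Classical in
/-- For an amplitude `b` supported in `B(e₂, ε₀)`, the transported amplitude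
`b_z(η) = b(Ψ^lam(z, η)) |det ∂_η Ψ^lam(z, η)|`, extended by zero off the domain of `Ψ^lam(z, ·)`. -/
def transported (φ : SpaceTime → Plane → ℝ) (ε₀ lam : ℝ) (z : SpaceTime) (b : Plane → ℂ)
    (η : Plane) : ℂ :=
  if η ∈ gradImage φ ε₀ (lam⁻¹ • z) then
    b (psiScaled φ ε₀ lam z η) * ((|(fderiv ℝ (psiScaled φ ε₀ lam z) η).det| : ℝ) : ℂ)
  else 0

/-! ### The angular and the radial decompositions -/

/-- Smooth angular partition of unity at scale `lam^{-1/2}`: functions `χ_ν`, `0 ≤ ν ≤ n` with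
`n ≈ lam^{1/2}`, homogeneous of degree zero, with sum one on `ℝ² ∖ 0`; for `ν ≥ 1` the function
`χ_ν` lives on a sector of aperture `O(lam^{-1/2})` about the direction `κ_ν`, and `χ_0` takes up
what the sectors do not cover. The constants are `K` (for size) and `Cχ m` (for derivatives of
order `m`). -/
structure IsAngularPartition (lam K : ℝ) (Cχ : ℕ → ℝ) (n : ℕ) (κ : Fin (n + 1) → Plane)
    (χ : Fin (n + 1) → Plane → ℝ) : Prop where
  card_lower : K⁻¹ * lam ^ (1 / 2 : ℝ) ≤ n
  card_upper : (n : ℝ) ≤ K * lam ^ (1 / 2 : ℝ)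
  norm_center : ∀ ν, ‖κ ν‖ = 1
  smooth : ∀ ν, ContDiffOn ℝ ∞ (χ ν) {0}ᶜ
  homogeneous : ∀ ν, ∀ η : Plane, η ≠ 0 → ∀ s : ℝ, 0 < s → χ ν (s • η) = χ ν η
  sum_eq_one : ∀ η : Plane, η ≠ 0 → ∑ ν, χ ν η = 1
  support_sector : ∀ ν, ν ≠ 0 → ∀ η : Plane, η ≠ 0 → χ ν η ≠ 0 →
    ‖‖η‖⁻¹ • η - κ ν‖ ≤ K * lam ^ (-(1 / 2) : ℝ)
  deriv_bound : ∀ ν, ∀ m : ℕ, ∀ η : Plane, ‖η‖ = 1 →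
    ‖iteratedFDeriv ℝ m (χ ν) η‖ ≤ Cχ m * lam ^ ((m : ℝ) / 2)

/-- The point of `ℝ²` with integer coordinates `j`. -/
def latticePt (j : Fin 2 → ℤ) : Plane := WithLp.toLp 2 (fun i => (j i : ℝ))

/-- `ρ ∈ C_c^∞(ℝ²)` whose integer translates sum to one. -/
structure IsLatticePartition (ρ : Plane → ℝ) : Prop where
  smooth : ContDiff ℝ ∞ ρ
  compact : HasCompactSupport ρ
  sum_eq_one : ∀ η : Plane, HasSum (fun j : Fin 2 → ℤ => ρ (η - latticePt j)) 1

/-! ### The extension operators -/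

/-- `g ↦ ∫ e^{i(⟨x, η⟩ + t h(η))} b(η) g(η) dη`, evaluated at `z = (x, t)`. -/
def extension (h : Plane → ℝ) (b : Plane → ℂ) (g : Plane → ℂ) (z : SpaceTime) : ℂ :=
  ∫ η : Plane, Complex.exp (Complex.I * ((inner ℝ z.1 η + z.2 * h η : ℝ) : ℂ)) * b η * g η

/-- The amplitude `a_{2,z}^ν`, where `a_2^ν = χ_ν a_2`. -/
def ampAngular (φ : SpaceTime → Plane → ℝ) (ε₀ lam : ℝ) (zc : SpaceTime) (a₂ : Plane → ℂ)
    (χν : Plane → ℝ) : Plane → ℂ :=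
  transported φ ε₀ lam zc (fun η => (χν η : ℂ) * a₂ η)

/-- `E_{zc}^ν g`, one angular piece. -/
def extAngular (φ : SpaceTime → Plane → ℝ) (ε₀ lam : ℝ) (zc : SpaceTime) (a₂ : Plane → ℂ)
    (χν : Plane → ℝ) (g : Plane → ℂ) : SpaceTime → ℂ :=
  extension (hFun φ ε₀ lam zc) (ampAngular φ ε₀ lam zc a₂ χν) g

/-- `E_{zc}^{ν,j} g`, the piece further localized by `ρ(lam^{1/2-ε/2} η - j)`. -/
def extBlock (φ : SpaceTime → Plane → ℝ) (ε₀ lam ε : ℝ) (zc : SpaceTime) (a₂ : Plane → ℂ)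
    (ρ : Plane → ℝ) (χν : Plane → ℝ) (j : Fin 2 → ℤ) (g : Plane → ℂ) : SpaceTime → ℂ :=
  extension (hFun φ ε₀ lam zc)
    (fun η => (ρ (lam ^ (1 / 2 - ε / 2) • η - latticePt j) : ℂ) *
      ampAngular φ ε₀ lam zc a₂ χν η) g

/-! ### Square functions, weights, rapid decay -/

/-- The square function `(∑ᵢ |Fᵢ|²)^{1/2}`, with values in `[0, ∞]`. -/
def squareFun {ι : Type} (F : ι → SpaceTime → ℂ) (z : SpaceTime) : ℝ≥0∞ :=
  (∑' i, ‖F i z‖ₑ ^ 2) ^ (1 / 2 : ℝ)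

/-- `w` is a weight adapted to the ball (or cube) centred at the origin of radius `r`, decaying of
order `N`: up to the factor `A`, it is `(1 + |z| / r)^{-N}`. -/
structure IsAdaptedWeight (w : SpaceTime → ℝ) (r : ℝ) (N : ℕ) (A : ℝ) : Prop where
  measurable : Measurable w
  lower : ∀ z, A⁻¹ * ((1 + stNorm z / r) ^ N)⁻¹ ≤ w z
  upper : ∀ z, w z ≤ A * ((1 + stNorm z / r) ^ N)⁻¹

/-- The norm of `L^{10/3}(w)`, for functions with values in `[0, ∞]`. -/
def weightedNorm (w : SpaceTime → ℝ) (G : SpaceTime → ℝ≥0∞) : ℝ≥0∞ :=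
  (∫⁻ z, G z ^ (10 / 3 : ℝ) * ENNReal.ofReal (w z)) ^ (3 / 10 : ℝ)

/-- `RapDec(lam)`: a nonnegative quantity that is `O(lam^{-M})` on `[1, ∞)` for every `M`. -/
def IsRapDec (q : ℝ → ℝ) : Prop :=
  ∀ M : ℕ, ∃ C : ℝ, ∀ lam : ℝ, 1 ≤ lam → 0 ≤ q lam ∧ q lam ≤ C * lam ^ (-(M : ℝ))

end RadialBlocks

end

/-! Fix the time t. The factor e^{ith} can be absorbed into the function being transformed, so each
block E^{ν,j}g(·,t) arises from F = E^νg(·,t) by inserting the frequency cutoff ρ(Rη - j), R =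
λ^{1/2-ε/2}. Fourier inversion for ρ gives an exact identity (`fourierInt_localized_eq`): at x the
block equals ∫ ρ̂(v) F(x + 2πRv) e^{-2πi⟨v,j⟩} dv. For fixed x the blocks are thus the integer
Fourier coefficients of one function of v, and a weighted Bessel inequality (`exists_bessel_const`)
bounds the sum of their squares by an average of |F|² over translates at scale R, with density
|ρ̂|²(1+v₁²)(1+v₂²) (`exists_tsum_localized_sq_le`). No error term appears, so RapDec can be zero.

After summing over ν, Jensen's inequality with exponent 5/3 and Fubini leave only the effect of
translations on w (`lintegral_rpow_average_mul_le`). A shift by 2πRv changes a weight adapted to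
radius r = λ^{1/2-ε} by at most A²q^N(1+2π|v|)^N, where q = R/r = λ^{ε/2}. The Schwartz decay of ρ̂
absorbs the polynomial in v, and the power 3/10 turns q^N into the loss λ^{3Nε/20}.

The phase enters only qualitatively: h is measurable where it matters, and the amplitudes are
continuous with compact support, so every integral converges absolutely. -/

open Topology Filter
open scoped FourierTransform SchwartzMap

noncomputable section

namespace RadialBlocks

/-! ### Smoothness of the inverse of an injective local diffeomorphism -/

section Inverse

variable {E : Type*} [NormedAddCommGroup E] [NormedSpace ℝ E] [FiniteDimensional ℝ E]

/-- A chosen inverse has no regularity by construction. Near `f a`, however, it and the inverse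
function theorem's local inverse both pick a preimage in `U`, so injectivity makes them agree. -/
lemma invFunOn_eventuallyEq_localInverse {f : E → E} {U : Set E} (hU : IsOpen U)
    (hinj : InjOn f U) {a : E} (ha : a ∈ U) (hf : ContDiffAt ℝ ∞ f a)
    (hdet : (fderiv ℝ f a).det ≠ 0) :
    ∃ g : E → E, ContDiffAt ℝ ∞ g (f a) ∧
      ∀ᶠ u in 𝓝 (f a), u ∈ f '' U ∧ Function.invFunOn f U u = g u := by
  let f' : E ≃L[ℝ] E := (fderiv ℝ f a).toContinuousLinearEquivOfDetNeZero hdet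
  have hd : HasFDerivAt f (f' : E →L[ℝ] E) a := by
    simpa [f'] using (hf.differentiableAt (by simp)).hasFDerivAt
  have hs : HasStrictFDerivAt f (f' : E →L[ℝ] E) a := hf.hasStrictFDerivAt' hd (by simp)
  refine ⟨hf.localInverse hd (by simp), hf.to_localInverse hd (by simp), ?_⟩
  have hmem : ∀ᶠ u in 𝓝 (f a), hf.localInverse hd (by simp) u ∈ U := by
    have := hs.localInverse_tendsto
    exact this.eventually (hU.mem_nhds ha)
  filter_upwards [hmem, hs.eventually_right_inverse] with u hu hru
  change f (hf.localInverse hd (by simp) u) = u at hru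
  have him : u ∈ f '' U := ⟨_, hu, hru⟩
  refine ⟨him, hinj (Function.invFunOn_mem him) hu ?_⟩
  rw [hru]
  exact Function.invFunOn_eq him

lemma contDiffAt_invFunOn {f : E → E} {U : Set E} (hU : IsOpen U) (hinj : InjOn f U)
    (hf : ∀ a ∈ U, ContDiffAt ℝ ∞ f a) (hdet : ∀ a ∈ U, (fderiv ℝ f a).det ≠ 0)
    {u : E} (hu : u ∈ f '' U) : ContDiffAt ℝ ∞ (Function.invFunOn f U) u := by
  obtain ⟨a, ha, rfl⟩ := hu
  obtain ⟨g, hg, he⟩ := invFunOn_eventuallyEq_localInverse hU hinj ha (hf a ha) (hdet a ha)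
  exact hg.congr_of_eventuallyEq (he.mono fun _ h => h.2)

lemma isOpen_image_of_det_ne_zero {f : E → E} {U : Set E} (hU : IsOpen U) (hinj : InjOn f U)
    (hf : ∀ a ∈ U, ContDiffAt ℝ ∞ f a) (hdet : ∀ a ∈ U, (fderiv ℝ f a).det ≠ 0) :
    IsOpen (f '' U) := by
  rw [isOpen_iff_mem_nhds]
  rintro _ ⟨a, ha, rfl⟩
  obtain ⟨g, -, he⟩ := invFunOn_eventuallyEq_localInverse hU hinj ha (hf a ha) (hdet a ha)
  exact he.mono fun _ h => h.1

end Inverse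

/-! ### Regularity of the transported amplitude and of `h` -/

lemma continuous_stNorm : Continuous stNorm := by
  unfold stNorm; fun_prop

lemma isOpen_stBall (r : ℝ) : IsOpen (stBall r) :=
  isOpen_lt continuous_stNorm continuous_const

lemma ball_subset_coneOver (ε₀ : ℝ) : Metric.ball e₂ ε₀ ⊆ coneOver ε₀ :=
  fun η hη => ⟨1, one_pos, η, hη, (one_smul ℝ η).symm⟩

lemma zero_notMem_ball {ε₀ : ℝ} (hε₀ : ε₀ < 1) : (0 : Plane) ∉ Metric.ball e₂ ε₀ := by
  have : ‖e₂‖ = 1 := by simp [e₂, EuclideanSpace.norm_eq, Fin.sum_univ_two]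
  simp only [Metric.mem_ball, dist_zero_left, this, not_lt]
  exact hε₀.le

namespace IsPhase

variable {φ : SpaceTime → Plane → ℝ} {ε₀ : ℝ}

lemma contDiffAt (hφ : IsPhase φ ε₀)
    {z : SpaceTime} (hz : z ∈ stBall ε₀) {η : Plane} (hη : η ∈ Metric.ball e₂ ε₀) :
    ContDiffAt ℝ ∞ (fun p : SpaceTime × Plane => φ p.1 p.2) (z, η) := by
  have hopen : IsOpen (stBall ε₀ ×ˢ Metric.ball e₂ ε₀) := (isOpen_stBall ε₀).prod Metric.isOpen_ball
  exact (hφ.smooth.mono (prod_mono_right (ball_subset_coneOver ε₀))).contDiffAt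
    (hopen.mem_nhds ⟨hz, hη⟩)

lemma contDiffAt_fderiv (hφ : IsPhase φ ε₀) {z : SpaceTime} (hz : z ∈ stBall ε₀) {η : Plane}
    (hη : η ∈ Metric.ball e₂ ε₀) :
    ContDiffAt ℝ ∞
      (fun ξ : Plane => fderiv ℝ (fun p : SpaceTime × Plane => φ p.1 p.2) (z, ξ)) η := by
  have h := (hφ.contDiffAt hz hη).fderiv_right (m := ∞) (by simp)
  exact ContDiffAt.comp (g := fderiv ℝ (fun p : SpaceTime × Plane => φ p.1 p.2))
    (f := fun ξ : Plane => (z, ξ)) η h (contDiffAt_const.prodMk contDiffAt_id)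

/-- Expressing the partial gradient through the full derivative lets its smoothness in `η` be read
off from the joint smoothness of `φ`. -/
lemma gradX_eq (hφ : IsPhase φ ε₀)
    {z : SpaceTime} (hz : z ∈ stBall ε₀) {η : Plane} (hη : η ∈ Metric.ball e₂ ε₀) :
    gradX φ z η = (InnerProductSpace.toDual ℝ Plane).symm
      ((fderiv ℝ (fun p : SpaceTime × Plane => φ p.1 p.2) (z, η)).comp
        ((ContinuousLinearMap.inl ℝ SpaceTime Plane).comp
          (ContinuousLinearMap.inl ℝ Plane ℝ))) := by
  have hd := ((hφ.contDiffAt hz hη).differentiableAt (by simp)).hasFDerivAt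
  have hi : HasFDerivAt (fun x : Plane => (((x, z.2) : SpaceTime), η))
      ((ContinuousLinearMap.inl ℝ SpaceTime Plane).comp (ContinuousLinearMap.inl ℝ Plane ℝ))
      z.1 := by
    have := ((hasFDerivAt_id (𝕜 := ℝ) z.1).prodMk (hasFDerivAt_const z.2 z.1)).prodMk
      (hasFDerivAt_const η z.1)
    exact this
  have hc := HasFDerivAt.comp (g := fun p : SpaceTime × Plane => φ p.1 p.2) z.1 hd hi
  unfold gradX gradient
  congr 1
  exact hc.fderiv

lemma contDiffAt_gradX (hφ : IsPhase φ ε₀) {z : SpaceTime} (hz : z ∈ stBall ε₀) {η : Plane}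
    (hη : η ∈ Metric.ball e₂ ε₀) : ContDiffAt ℝ ∞ (gradX φ z) η := by
  have h1 := (hφ.contDiffAt_fderiv hz hη).clm_comp (contDiffAt_const (c :=
    (ContinuousLinearMap.inl ℝ SpaceTime Plane).comp (ContinuousLinearMap.inl ℝ Plane ℝ)))
  have h2 := (InnerProductSpace.toDual ℝ Plane).symm.toContinuousLinearEquiv.contDiff (n := ∞)
    |>.contDiffAt.comp η h1
  refine h2.congr_of_eventuallyEq ?_
  filter_upwards [Metric.isOpen_ball.mem_nhds hη] with ξ hξ using hφ.gradX_eq hz hξ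

lemma isOpen_gradImage (hφ : IsPhase φ ε₀)
    {z : SpaceTime} (hz : z ∈ stBall ε₀) : IsOpen (gradImage φ ε₀ z) :=
  isOpen_image_of_det_ne_zero Metric.isOpen_ball (hφ.injOn z hz)
    (fun _ h => hφ.contDiffAt_gradX hz h) (hφ.det_ne_zero z hz)

lemma contDiffAt_psi (hφ : IsPhase φ ε₀) {z : SpaceTime} (hz : z ∈ stBall ε₀) {η : Plane}
    (hη : η ∈ gradImage φ ε₀ z) : ContDiffAt ℝ ∞ (psi φ ε₀ z) η :=
  contDiffAt_invFunOn Metric.isOpen_ball (hφ.injOn z hz)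
    (fun _ h => hφ.contDiffAt_gradX hz h) (hφ.det_ne_zero z hz) hη

lemma psi_mem {z : SpaceTime} {η : Plane} (hη : η ∈ gradImage φ ε₀ z) :
    psi φ ε₀ z η ∈ Metric.ball e₂ ε₀ := Function.invFunOn_mem hη

lemma derivT_phaseScaled_eq (hφ : IsPhase φ ε₀)
    {lam : ℝ} {z : SpaceTime} (hz : lam⁻¹ • z ∈ stBall ε₀) {η : Plane}
    (hη : η ∈ Metric.ball e₂ ε₀) :
    derivT (phaseScaled φ lam) z η =
      lam * fderiv ℝ (fun p : SpaceTime × Plane => φ p.1 p.2) (lam⁻¹ • z, η)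
        ((lam⁻¹ • ((0 : Plane), (1 : ℝ)) : SpaceTime), (0 : Plane)) := by
  have hd := ((hφ.contDiffAt hz hη).differentiableAt (by simp)).hasFDerivAt
  have hi : HasDerivAt (fun t : ℝ => ((lam⁻¹ • ((z.1, t) : SpaceTime)), η))
      ((lam⁻¹ • ((0 : Plane), (1 : ℝ)) : SpaceTime), (0 : Plane)) z.2 :=
    (((hasDerivAt_const z.2 z.1).prodMk (hasDerivAt_id z.2)).const_smul lam⁻¹).prodMk
      (hasDerivAt_const z.2 η)
  exact ((HasFDerivAt.comp_hasDerivAt (l := fun p : SpaceTime × Plane => φ p.1 p.2)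
    z.2 hd hi).const_mul lam).deriv

lemma continuousOn_hFun (hφ : IsPhase φ ε₀) {lam : ℝ} {z : SpaceTime} (hz : lam⁻¹ • z ∈ stBall ε₀) :
    ContinuousOn (hFun φ ε₀ lam z) (gradImage φ ε₀ (lam⁻¹ • z)) := by
  have hc : ContinuousOn (derivT (phaseScaled φ lam) z) (Metric.ball e₂ ε₀) := by
    refine ContinuousOn.congr ?_ fun η hη => hφ.derivT_phaseScaled_eq hz hη
    intro η hη
    have := (hφ.contDiffAt_fderiv hz hη).continuousAt
    exact (continuousAt_const.mul (this.clm_apply continuousAt_const)).continuousWithinAt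
  exact hc.comp (fun η hη => (hφ.contDiffAt_psi hz hη).continuousAt.continuousWithinAt)
    fun η hη => psi_mem hη

lemma transported_eq_zero {lam : ℝ} {z : SpaceTime} {b : Plane → ℂ} {k : Set Plane}
    (hb : ∀ η ∉ k, b η = 0) {η : Plane} (hη : η ∉ gradX φ (lam⁻¹ • z) '' k) :
    transported φ ε₀ lam z b η = 0 := by
  unfold transported
  split_ifs with h
  · rw [hb, zero_mul]
    exact fun hk => hη ⟨_, hk, Function.invFunOn_eq h⟩
  · rfl

lemma isCompact_image_gradX (hφ : IsPhase φ ε₀) {z : SpaceTime} (hz : z ∈ stBall ε₀) {k : Set Plane}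
    (hk : IsCompact k) (hkb : k ⊆ Metric.ball e₂ ε₀) : IsCompact (gradX φ z '' k) :=
  hk.image_of_continuousOn fun _ h =>
    (hφ.contDiffAt_gradX hz (hkb h)).continuousAt.continuousWithinAt

lemma hasCompactSupport_transported (hφ : IsPhase φ ε₀)
    {lam : ℝ} {z : SpaceTime} (hz : lam⁻¹ • z ∈ stBall ε₀)
    {b : Plane → ℂ} {k : Set Plane} (hk : IsCompact k) (hkb : k ⊆ Metric.ball e₂ ε₀)
    (hb : ∀ η ∉ k, b η = 0) : HasCompactSupport (transported φ ε₀ lam z b) :=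
  HasCompactSupport.intro (hφ.isCompact_image_gradX hz hk hkb)
    fun _ h => transported_eq_zero hb h

lemma continuous_transported (hφ : IsPhase φ ε₀)
    {lam : ℝ} {z : SpaceTime} (hz : lam⁻¹ • z ∈ stBall ε₀)
    {b : Plane → ℂ} (hbc : ContinuousOn b (Metric.ball e₂ ε₀)) {k : Set Plane}
    (hk : IsCompact k) (hkb : k ⊆ Metric.ball e₂ ε₀) (hb : ∀ η ∉ k, b η = 0) :
    Continuous (transported φ ε₀ lam z b) := by
  rw [continuous_iff_continuousAt]
  intro η
  by_cases hη : η ∈ gradImage φ ε₀ (lam⁻¹ • z)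
  · have hψ := hφ.contDiffAt_psi hz hη
    have h1 : ContinuousAt (fun ξ => b (psiScaled φ ε₀ lam z ξ)) η :=
      ContinuousAt.comp (g := b)
        (hbc.continuousAt (Metric.isOpen_ball.mem_nhds (psi_mem hη))) hψ.continuousAt
    have h2 : ContinuousAt (fderiv ℝ (psiScaled φ ε₀ lam z)) η :=
      (hψ.fderiv_right (m := 0) (by simp)).continuousAt
    have h3 : ContinuousAt (fun ξ => (fderiv ℝ (psiScaled φ ε₀ lam z) ξ).det) η :=
      ContinuousLinearMap.continuous_det.continuousAt.comp h2
    refine (h1.mul (Complex.continuous_ofReal.continuousAt.comp h3.abs)).congr ?_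
    filter_upwards [(hφ.isOpen_gradImage hz).mem_nhds hη] with ξ hξ
    simp [transported, hξ]
  -- Off the image, including on its boundary, the extension by zero is continuous: the amplitude
  -- lives on the compact set `gradX '' k`, whose complement is an open neighbourhood of `η`.
  · have hS : (gradX φ (lam⁻¹ • z) '' k)ᶜ ∈ 𝓝 η :=
      (hφ.isCompact_image_gradX hz hk hkb).isClosed.isOpen_compl.mem_nhds
        fun h => hη (image_mono hkb h)
    refine (continuousAt_const (y := (0 : ℂ))).congr ?_
    filter_upwards [hS] with ξ hξ using (transported_eq_zero hb hξ).symm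

end IsPhase

/-! ### A Bessel inequality for exponentials against a decaying weight -/

section Bessel

attribute [local instance] instMeasureSpaceUnitAddCircle

/-- Parseval for trigonometric polynomials, from orthonormality of the characters in L² of the
torus. -/
lemma lintegral_enorm_sq_sum_mFourier {d : Type*} [Fintype d] (s : Finset (d → ℤ))
    (α : (d → ℤ) → ℂ) :
    ∫⁻ x : UnitAddTorus d, ‖∑ j ∈ s, α j * UnitAddTorus.mFourier j x‖ₑ ^ 2 =
      ∑ j ∈ s, ‖α j‖ₑ ^ 2 := by
  have : IsProbabilityMeasure (volume : Measure UnitAddCircle) :=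
    inferInstanceAs (IsProbabilityMeasure AddCircle.haarAddCircle)
  let f : C(UnitAddTorus d, ℂ) := ∑ j ∈ s, α j • UnitAddTorus.mFourier j
  have hf : ∀ x, f x = ∑ j ∈ s, α j * UnitAddTorus.mFourier j x := fun x => by
    simp [f, ContinuousMap.sum_apply]
  simp_rw [← hf]
  have hLp : ContinuousMap.toLp (E := ℂ) 2 volume ℂ f
      = ∑ j ∈ s, α j • UnitAddTorus.mFourierLp 2 j := by
    simp [f, map_sum]
  have hn : ‖ContinuousMap.toLp (E := ℂ) 2 volume ℂ f‖ ^ 2 = ∑ j ∈ s, ‖α j‖ ^ 2 := by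
    rw [hLp]
    have h := UnitAddTorus.orthonormal_mFourier.inner_sum α α s
    rw [inner_self_eq_norm_sq_to_K] at h
    have h2 : ∑ i ∈ s, (starRingEnd ℂ) (α i) * α i = ((∑ j ∈ s, ‖α j‖ ^ 2 : ℝ) : ℂ) := by
      push_cast
      exact Finset.sum_congr rfl fun i _ => RCLike.conj_mul (α i)
    rw [h2] at h
    exact Complex.ofReal_injective (by push_cast; push_cast at h; exact h)
  have he : ‖ContinuousMap.toLp (E := ℂ) 2 volume ℂ f‖ₑ ^ 2 = ∫⁻ x, ‖f x‖ₑ ^ 2 := by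
    rw [Lp.enorm_def, eLpNorm_congr_ae (ContinuousMap.coeFn_toLp volume f),
      eLpNorm_eq_lintegral_rpow_enorm_toReal (by simp) (by simp)]
    rw [← ENNReal.rpow_natCast, ← ENNReal.rpow_mul]
    simp
  rw [← he, ← ofReal_norm, ← ENNReal.ofReal_pow (norm_nonneg _), hn,
    ENNReal.ofReal_sum_of_nonneg (fun _ _ => by positivity)]
  exact Finset.sum_congr rfl fun i _ => by
    rw [ENNReal.ofReal_pow (norm_nonneg _), ofReal_norm]

/-- The half-open unit cell with lower corner `k`. -/
def unitCell {d : Type*} (k : d → ℤ) : Set (d → ℝ) :=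
  {x | ∀ i, x i ∈ Ioc (k i : ℝ) (k i + 1)}

/-- Each point determines its cell, which yields both covering and disjointness. Cells are open on
the left, hence the corner `⌈x i⌉ - 1` rather than a floor. -/
lemma mem_unitCell_iff {d : Type*} {k : d → ℤ} {x : d → ℝ} :
    x ∈ unitCell k ↔ k = fun i => ⌈x i⌉ - 1 := by
  simp only [unitCell, mem_ofPred_eq, mem_Ioc, funext_iff]
  refine forall_congr' fun i => ?_
  rw [eq_sub_iff_add_eq, eq_comm (b := ⌈x i⌉), Int.ceil_eq_iff]
  push_cast
  constructor <;> rintro ⟨h1, h2⟩ <;> constructor <;> linarith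

lemma measurableSet_unitCell {d : Type*} [Countable d] (k : d → ℤ) :
    MeasurableSet (unitCell k) :=
  MeasurableSet.univ_pi' fun _ => measurableSet_Ioc

lemma lintegral_eq_tsum_unitCell {d : Type*} [Fintype d] (f : (d → ℝ) → ℝ≥0∞) :
    ∫⁻ x, f x = ∑' k : d → ℤ, ∫⁻ x in unitCell k, f x := by
  rw [← lintegral_iUnion measurableSet_unitCell]
  · have : (⋃ k : d → ℤ, unitCell k) = univ :=
      eq_univ_of_forall fun x => mem_iUnion.2 ⟨_, mem_unitCell_iff.2 rfl⟩
    rw [this, Measure.restrict_univ]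
  · intro k l hkl
    refine Set.disjoint_left.2 fun x hk hl => hkl ?_
    rw [mem_unitCell_iff.1 hk, mem_unitCell_iff.1 hl]

/-- A trigonometric polynomial is periodic, so its L² mass is the same on every cell and Parseval
computes it; the weight only contributes the sum of its bounds over cells. -/
lemma lintegral_weight_mul_enorm_sq_sum_le {d : Type*} [Fintype d] (W : (d → ℝ) → ℝ≥0∞)
    (c : (d → ℤ) → ℝ)
    (hW : ∀ k, ∀ x ∈ unitCell k, W x ≤ ENNReal.ofReal (c k))
    (s : Finset (d → ℤ)) (α : (d → ℤ) → ℂ) :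
    ∫⁻ x : d → ℝ, W x *
        ‖∑ j ∈ s, α j * UnitAddTorus.mFourier j (fun i => (x i : UnitAddCircle))‖ₑ ^ 2
      ≤ (∑' k, ENNReal.ofReal (c k)) * ∑ j ∈ s, ‖α j‖ₑ ^ 2 := by
  rw [lintegral_eq_tsum_unitCell, ← ENNReal.tsum_mul_right]
  refine ENNReal.tsum_le_tsum fun k => ?_
  rw [← lintegral_enorm_sq_sum_mFourier s α, UnitAddTorus.lintegral_preimage _ fun i => (k i : ℝ)]
  refine (setLIntegral_mono' (measurableSet_unitCell k) fun x hx =>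
    mul_le_mul_left (hW k x hx) _).trans ?_
  rw [lintegral_const_mul']
  · rfl
  · exact ENNReal.ofReal_ne_top

end Bessel

/-- The weight `∏ᵢ (1 + xᵢ²)⁻¹`. -/
def cauchyWeight {d : Type*} [Fintype d] (x : d → ℝ) : ℝ := ∏ i, (1 + x i ^ 2)⁻¹

lemma cauchyWeight_pos {d : Type*} [Fintype d] (x : d → ℝ) : 0 < cauchyWeight x :=
  Finset.prod_pos fun i _ => by positivity

lemma continuous_cauchyWeight {d : Type*} [Fintype d] :
    Continuous (cauchyWeight : (d → ℝ) → ℝ) :=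
  continuous_finsetProd _ fun i _ => Continuous.inv₀ (by fun_prop) fun x => by positivity

/-- Since `|x i - k i| ≤ 1`, one has `1 + k² ≤ 3 + 2x² ≤ 3(1 + x²)` in each coordinate. -/
lemma cauchyWeight_le_of_mem_unitCell (k : Fin 2 → ℤ) {x : Fin 2 → ℝ} (hx : x ∈ unitCell k) :
    cauchyWeight x ≤ (3 * (1 + (k 0 : ℝ) ^ 2)⁻¹) * (3 * (1 + (k 1 : ℝ) ^ 2)⁻¹) := by
  have key : ∀ i, (1 + x i ^ 2)⁻¹ ≤ 3 * (1 + (k i : ℝ) ^ 2)⁻¹ := fun i => by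
    obtain ⟨h1, h2⟩ := hx i
    rw [← div_eq_mul_inv, inv_eq_one_div, div_le_div_iff₀ (by positivity) (by positivity)]
    nlinarith [sq_nonneg (2 * x i - k i), sq_nonneg (x i - k i)]
  rw [cauchyWeight, Fin.prod_univ_two]
  exact mul_le_mul (key 0) (key 1) (by positivity) (by positivity)

lemma tsum_unitCell_bound_ne_top :
    ∑' k : Fin 2 → ℤ, ENNReal.ofReal
      ((3 * (1 + (k 0 : ℝ) ^ 2)⁻¹) * (3 * (1 + (k 1 : ℝ) ^ 2)⁻¹)) ≠ ⊤ := by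
  have hs : Summable fun m : ℤ => 3 * (1 + (m : ℝ) ^ 2)⁻¹ := by
    refine Summable.mul_left _ ?_
    refine Summable.of_norm_bounded_eventually (g := fun m : ℤ => 1 / (m : ℝ) ^ 2)
      (Real.summable_one_div_int_pow.2 one_lt_two) ?_
    filter_upwards [(Set.finite_singleton (0 : ℤ)).compl_mem_cofinite] with m hm
    have : (m : ℝ) ≠ 0 := by exact_mod_cast hm
    rw [Real.norm_of_nonneg (by positivity), inv_eq_one_div]
    exact one_div_le_one_div_of_le (by positivity) (by linarith)
  have hp : Summable fun q : ℤ × ℤ =>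
      (3 * (1 + (q.1 : ℝ) ^ 2)⁻¹) * (3 * (1 + (q.2 : ℝ) ^ 2)⁻¹) :=
    hs.mul_of_nonneg hs (fun m => by positivity) fun m => by positivity
  have := (finTwoArrowEquiv ℤ).summable_iff.2 hp
  exact Summable.tsum_ofReal_ne_top this

lemma norm_mFourier_apply_le {d : Type*} [Fintype d] (j : d → ℤ) (x : UnitAddTorus d) :
    ‖UnitAddTorus.mFourier j x‖ ≤ 1 :=
  ((UnitAddTorus.mFourier j).norm_coe_le_norm x).trans UnitAddTorus.mFourier_norm.le

lemma continuous_mFourier_coe {d : Type*} [Fintype d] (j : d → ℤ) :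
    Continuous fun v : d → ℝ => UnitAddTorus.mFourier j (fun i => (v i : UnitAddCircle)) :=
  (UnitAddTorus.mFourier j).continuous.comp
    (continuous_pi fun i => (AddCircle.continuous_mk' 1).comp (continuous_apply i))

lemma integrable_mul_mFourier {d : Type*} [Fintype d] {p : (d → ℝ) → ℂ} (hp : Integrable p)
    (j : d → ℤ) :
    Integrable fun v => p v * UnitAddTorus.mFourier j (fun i => (v i : UnitAddCircle)) :=
  hp.mul_bdd (c := 1) (continuous_mFourier_coe j).aestronglyMeasurable
    (Eventually.of_forall fun _ => norm_mFourier_apply_le j _)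

/-- Cauchy-Schwarz with a positive weight. -/
lemma lintegral_mul_sq_le_of_weight {X : Type*} [MeasurableSpace X] {μ : Measure X}
    {f g : X → ℝ≥0∞} {W : X → ℝ} (hf : AEMeasurable f μ) (hg : AEMeasurable g μ)
    (hW : Measurable W) (hpos : ∀ x, 0 < W x) :
    (∫⁻ x, f x * g x ∂μ) ^ 2 ≤
      (∫⁻ x, f x ^ 2 * ENNReal.ofReal (W x)⁻¹ ∂μ) * ∫⁻ x, ENNReal.ofReal (W x) * g x ^ 2 ∂μ := by
  have hW1 : AEMeasurable (fun x => ENNReal.ofReal (W x)⁻¹ ^ (1 / 2 : ℝ)) μ :=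
    (hW.inv.ennreal_ofReal.pow_const _).aemeasurable
  have hW2 : AEMeasurable (fun x => ENNReal.ofReal (W x) ^ (1 / 2 : ℝ)) μ :=
    (hW.ennreal_ofReal.pow_const _).aemeasurable
  have h := ENNReal.lintegral_mul_le_Lp_mul_Lq μ Real.HolderConjugate.two_two
    (hf.mul hW1) (hW2.mul hg)
  have e1 : ∀ x, f x * g x = (f x * ENNReal.ofReal (W x)⁻¹ ^ (1 / 2 : ℝ)) *
      (ENNReal.ofReal (W x) ^ (1 / 2 : ℝ) * g x) := fun x => by
    have : ENNReal.ofReal (W x)⁻¹ ^ (1 / 2 : ℝ) * ENNReal.ofReal (W x) ^ (1 / 2 : ℝ) = 1 := by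
      rw [← ENNReal.mul_rpow_of_nonneg _ _ (by norm_num), ← ENNReal.ofReal_mul
        (inv_nonneg.2 (hpos x).le), inv_mul_cancel₀ (hpos x).ne']
      simp
    rw [mul_assoc, ← mul_assoc _ _ (g x), this, one_mul]
  have e2 : ∀ a b : ℝ≥0∞, (a * b ^ (1 / 2 : ℝ)) ^ (2 : ℝ) = a ^ 2 * b := fun a b => by
    rw [ENNReal.mul_rpow_of_nonneg _ _ (by norm_num), ← ENNReal.rpow_mul]
    norm_num
  have e3 : ∀ a b : ℝ≥0∞, (b ^ (1 / 2 : ℝ) * a) ^ (2 : ℝ) = b * a ^ 2 := fun a b => by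
    rw [mul_comm, e2, mul_comm]
  have e4 : ∀ a : ℝ≥0∞, (a ^ (1 / 2 : ℝ)) ^ 2 = a := fun a => by
    rw [← ENNReal.rpow_natCast, ← ENNReal.rpow_mul]; norm_num
  simp only [Pi.mul_apply, e2, e3] at h
  simp_rw [e1]
  refine (pow_le_pow_left' h 2).trans_eq ?_
  rw [mul_pow, e4, e4]

/-- Bessel's inequality for the Fourier coefficients, at integer frequencies, of a function on the
plane; the periodization of the function is controlled by the weight. -/
lemma exists_bessel_const : ∃ B : ℝ≥0∞, B ≠ ⊤ ∧ ∀ p : (Fin 2 → ℝ) → ℂ, Integrable p →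
    ∑' j : Fin 2 → ℤ, ‖∫ v : Fin 2 → ℝ,
        p v * UnitAddTorus.mFourier j (fun i => (v i : UnitAddCircle))‖ₑ ^ 2
      ≤ B * ∫⁻ v, ‖p v‖ₑ ^ 2 * ENNReal.ofReal (cauchyWeight v)⁻¹ := by
  refine ⟨_, tsum_unitCell_bound_ne_top, fun p hp => ?_⟩
  set B := ∑' k : Fin 2 → ℤ, ENNReal.ofReal
      ((3 * (1 + (k 0 : ℝ) ^ 2)⁻¹) * (3 * (1 + (k 1 : ℝ) ^ 2)⁻¹))
  set X := ∫⁻ v, ‖p v‖ₑ ^ 2 * ENNReal.ofReal (cauchyWeight v)⁻¹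
  rw [ENNReal.tsum_eq_iSup_sum]
  refine iSup_le fun s => ?_
  set c : (Fin 2 → ℤ) → ℂ := fun j => ∫ v : Fin 2 → ℝ,
        p v * UnitAddTorus.mFourier j (fun i => (v i : UnitAddCircle))
  set S := ∑ j ∈ s, ‖c j‖ₑ ^ 2 with hS
  -- Duality: testing `p` against the polynomial with the conjugate coefficients reproduces the sum
  -- `S`.
  let T : (Fin 2 → ℝ) → ℂ := fun v =>
    ∑ j ∈ s, (starRingEnd ℂ) (c j) * UnitAddTorus.mFourier j (fun i => (v i : UnitAddCircle))
  have hT : Continuous T :=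
    continuous_finsetSum _ fun j _ => continuous_const.mul (continuous_mFourier_coe j)
  have h1 : ∫ v, p v * T v = ((∑ j ∈ s, ‖c j‖ ^ 2 : ℝ) : ℂ) := by
    have : ∀ v, p v * T v = ∑ j ∈ s, (starRingEnd ℂ) (c j) *
        (p v * UnitAddTorus.mFourier j (fun i => (v i : UnitAddCircle))) := fun v => by
      simp only [T, Finset.mul_sum]
      exact Finset.sum_congr rfl fun j _ => by ring
    simp_rw [this]
    rw [integral_finsetSum _ fun j _ => (integrable_mul_mFourier hp j).const_mul _]
    push_cast
    refine Finset.sum_congr rfl fun j _ => ?_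
    rw [integral_const_mul]
    exact RCLike.conj_mul (c j)
  have h2 : S = ‖∫ v, p v * T v‖ₑ := by
    rw [h1, ← ofReal_norm, Complex.norm_of_nonneg (by positivity),
      ENNReal.ofReal_sum_of_nonneg (fun _ _ => by positivity), hS]
    exact Finset.sum_congr rfl fun i _ => by
      rw [ENNReal.ofReal_pow (norm_nonneg _), ofReal_norm]
  have h3 : S ≤ ∫⁻ v, ‖p v‖ₑ * ‖T v‖ₑ := by
    rw [h2]
    refine (enorm_integral_le_lintegral_enorm _).trans_eq ?_
    simp_rw [enorm_mul]
  -- Weighted Cauchy-Schwarz, with `∫ W |T|² ≤ B S` from the cell-by-cell Parseval bound. One factor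
  -- `S` then cancels, which is legitimate because the finite sum `S` is finite.
  have h4 : S ^ 2 ≤ X * (B * S) := by
    refine (pow_le_pow_left' h3 2).trans ?_
    refine (lintegral_mul_sq_le_of_weight hp.1.enorm hT.enorm.measurable.aemeasurable
      continuous_cauchyWeight.measurable cauchyWeight_pos).trans ?_
    refine mul_le_mul_right ?_ _
    refine (lintegral_weight_mul_enorm_sq_sum_le _ _ (fun k x hx =>
      ENNReal.ofReal_le_ofReal (cauchyWeight_le_of_mem_unitCell k hx)) s _).trans_eq ?_
    simp [hS, B]
  have hSt : S ≠ ⊤ := ENNReal.sum_ne_top.2 fun j _ => by simp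
  rcases eq_or_ne S 0 with h0 | h0
  · rw [h0]; exact zero_le
  · rw [sq, ← mul_assoc, mul_comm X B] at h4
    exact (ENNReal.mul_le_mul_iff_left h0 hSt).1 h4

/-! ### Lattice blocks of a Fourier integral -/

lemma mFourier_coe_eq_exp (j : Fin 2 → ℤ) (v : Plane) :
    UnitAddTorus.mFourier j (fun i => (v i : UnitAddCircle)) =
      Complex.exp (Complex.I * ((2 * Real.pi * inner ℝ v (latticePt j) : ℝ) : ℂ)) := by
  simp only [UnitAddTorus.mFourier, ContinuousMap.coe_mk, fourier_coe_apply, ← Complex.exp_sum]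
  congr 1
  simp only [latticePt, PiLp.inner_apply, Fin.sum_univ_two]
  simp
  ring

lemma exists_bessel_const_plane : ∃ B : ℝ≥0∞, B ≠ ⊤ ∧ ∀ p : Plane → ℂ, Integrable p →
    ∑' j : Fin 2 → ℤ, ‖∫ v : Plane,
        p v * Complex.exp (Complex.I * ((2 * Real.pi * inner ℝ v (latticePt j) : ℝ) : ℂ))‖ₑ ^ 2
      ≤ B * ∫⁻ v, ‖p v‖ₑ ^ 2 * ENNReal.ofReal (cauchyWeight v.ofLp)⁻¹ := by
  obtain ⟨B, hB, h⟩ := exists_bessel_const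
  refine ⟨B, hB, fun p hp => ?_⟩
  have hmp := PiLp.volume_preserving_toLp (Fin 2)
  have hme : MeasurableEmbedding (WithLp.toLp 2 : (Fin 2 → ℝ) → Plane) :=
    (MeasurableEquiv.toLp 2 (Fin 2 → ℝ)).measurableEmbedding
  have h' := h (fun v => p (WithLp.toLp 2 v)) ((hmp.integrable_comp_emb hme).2 hp)
  rw [← hmp.lintegral_comp_emb hme]
  refine le_of_eq_of_le (tsum_congr fun j => ?_) h'
  rw [← hmp.integral_comp hme]
  simp_rw [← mFourier_coe_eq_exp]

lemma norm_exp_I_mul_ofReal (s : ℝ) : ‖Complex.exp (Complex.I * (s : ℂ))‖ = 1 := by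
  rw [mul_comm]; exact Complex.norm_exp_ofReal_mul_I s

/-- The Fourier integral `x ↦ ∫ e^{i⟨x, η⟩} f(η) dη`. -/
def fourierInt (f : Plane → ℂ) (x : Plane) : ℂ :=
  ∫ η, Complex.exp (Complex.I * ((inner ℝ x η : ℝ) : ℂ)) * f η

lemma continuous_fourierInt {f : Plane → ℂ} (hf : Integrable f) : Continuous (fourierInt f) := by
  refine continuous_of_dominated (bound := fun η => ‖f η‖) (fun x => ?_) (fun x => ?_) hf.norm ?_
  · exact (Continuous.aestronglyMeasurable (by fun_prop)).mul hf.1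
  · exact Eventually.of_forall fun η => by rw [norm_mul, norm_exp_I_mul_ofReal, one_mul]
  · exact Eventually.of_forall fun η => by fun_prop

lemma norm_fourierInt_le (f : Plane → ℂ) (x : Plane) : ‖fourierInt f x‖ ≤ ∫ η, ‖f η‖ := by
  refine (norm_integral_le_integral_norm _).trans_eq ?_
  simp_rw [norm_mul, norm_exp_I_mul_ofReal, one_mul]

lemma schwartz_eq_integral_fourier (θ : 𝓢(Plane, ℂ)) (ξ : Plane) :
    θ ξ = ∫ v, Complex.exp (Complex.I * ((2 * Real.pi * inner ℝ v ξ : ℝ) : ℂ)) * (𝓕 θ) v := by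
  have h : 𝓕⁻ (𝓕 θ) = θ := FourierTransform.fourierInv_fourier_eq θ
  rw [← h, SchwartzMap.fourierInv_coe, Real.fourierInv_eq', h]
  refine integral_congr_ae (Eventually.of_forall fun v => ?_)
  simp only [smul_eq_mul]
  rw [mul_comm Complex.I]

/-- A frequency localization of `∫ e^{i⟨x, η⟩} f(η) dη` is an average of its translates. -/
lemma fourierInt_localized_eq (θ : 𝓢(Plane, ℂ)) {f : Plane → ℂ} (hf : Integrable f) (R : ℝ)
    (x ζ : Plane) :
    fourierInt (fun η => θ (R • η - ζ) * f η) x =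
      ∫ v, (𝓕 θ) v * fourierInt f (x + (2 * Real.pi * R) • v) *
        Complex.exp (Complex.I * ((2 * Real.pi * inner ℝ v (-ζ) : ℝ) : ℂ)) := by
  let k : Plane → Plane → ℂ := fun η v =>
    Complex.exp (Complex.I * ((inner ℝ x η + 2 * Real.pi * inner ℝ v (R • η - ζ) : ℝ) : ℂ)) *
      (f η * (𝓕 θ) v)
  have hint : Integrable (Function.uncurry k) (volume.prod volume) := by
    refine Integrable.bdd_mul (c := 1) (hf.mul_prod (𝓕 θ).integrable) ?_ ?_
    · exact Continuous.aestronglyMeasurable (by fun_prop)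
    · exact Eventually.of_forall fun q => (norm_exp_I_mul_ofReal _).le
  have h1 : fourierInt (fun η => θ (R • η - ζ) * f η) x = ∫ η, ∫ v, k η v := by
    refine integral_congr_ae (Eventually.of_forall fun η => ?_)
    simp only [schwartz_eq_integral_fourier θ (R • η - ζ), k]
    rw [← integral_mul_const, ← integral_const_mul]
    refine integral_congr_ae (Eventually.of_forall fun v => ?_)
    simp only [Complex.ofReal_add, mul_add, Complex.exp_add]
    ring
  rw [h1, integral_integral_swap hint]
  refine integral_congr_ae (Eventually.of_forall fun v => ?_)
  simp only [fourierInt, k]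
  rw [← integral_const_mul, ← integral_mul_const]
  refine integral_congr_ae (Eventually.of_forall fun η => ?_)
  have e : (inner ℝ x η + 2 * Real.pi * inner ℝ v (R • η - ζ) : ℝ) =
      inner ℝ (x + (2 * Real.pi * R) • v) η + 2 * Real.pi * inner ℝ v (-ζ) := by
    simp only [inner_add_left, inner_sub_right, inner_smul_left, inner_smul_right, inner_neg_right]
    simp
    ring
  simp only [e, Complex.ofReal_add, mul_add, Complex.exp_add]
  ring

lemma latticePt_neg (j : Fin 2 → ℤ) : latticePt (-j) = -latticePt j := by
  ext i; simp [latticePt]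

/-- The weight `|θ̂(v)|² (1 + v₁²) (1 + v₂²)` attached to a cutoff `θ`. -/
def cutoffWeight (θ : 𝓢(Plane, ℂ)) (v : Plane) : ℝ≥0∞ :=
  ‖(𝓕 θ) v‖ₑ ^ 2 * ENNReal.ofReal (cauchyWeight v.ofLp)⁻¹

lemma measurable_cutoffWeight (θ : 𝓢(Plane, ℂ)) : Measurable (cutoffWeight θ) := by
  have h : Measurable fun v : Plane => cauchyWeight v.ofLp :=
    continuous_cauchyWeight.measurable.comp (by fun_prop)
  exact ((𝓕 θ).continuous.enorm.measurable.pow_const 2).mul h.inv.ennreal_ofReal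

lemma inv_cauchyWeight_le (v : Plane) : (cauchyWeight v.ofLp)⁻¹ ≤ (1 + ‖v‖) ^ 4 := by
  have key : ∀ i, 1 + v i ^ 2 ≤ (1 + ‖v‖) ^ 2 := fun i => by
    have h := PiLp.norm_apply_le v i
    rw [Real.norm_eq_abs] at h
    nlinarith [sq_abs (v i), abs_nonneg (v i), norm_nonneg v]
  rw [cauchyWeight, Fin.prod_univ_two, mul_inv, inv_inv, inv_inv]
  calc (1 + v 0 ^ 2) * (1 + v 1 ^ 2) ≤ (1 + ‖v‖) ^ 2 * (1 + ‖v‖) ^ 2 :=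
        mul_le_mul (key 0) (key 1) (by positivity) (by positivity)
    _ = (1 + ‖v‖) ^ 4 := by ring

/-- One factor of `|θ̂|²` is bounded by its supremum; the other is integrable against the remaining
polynomial of degree `N + 4`, where 4 comes from the inverse Cauchy weight. The 7 below dominates
2π. -/
lemma lintegral_cutoffWeight_mul_pow_ne_top (θ : 𝓢(Plane, ℂ)) (N : ℕ) :
    ∫⁻ v, cutoffWeight θ v * ENNReal.ofReal ((1 + 2 * Real.pi * ‖v‖) ^ N) ≠ ⊤ := by
  obtain ⟨M, hM0, hM⟩ := (𝓕 θ).decay 0 0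
  simp only [pow_zero, one_mul, norm_iteratedFDeriv_zero] at hM
  have hi : Integrable fun v : Plane => (M * 7 ^ N * 2 ^ (N + 4)) *
      (‖v‖ ^ 0 * ‖(𝓕 θ) v‖ + ‖v‖ ^ (N + 4) * ‖(𝓕 θ) v‖) :=
    (((𝓕 θ).integrable_pow_mul volume 0).add
      ((𝓕 θ).integrable_pow_mul volume (N + 4))).const_mul _
  refine ((lintegral_mono fun v => ?_).trans_lt hi.lintegral_lt_top).ne
  rw [cutoffWeight, ← ofReal_norm, ← ENNReal.ofReal_pow (norm_nonneg _),
    ← ENNReal.ofReal_mul (by positivity), ← ENNReal.ofReal_mul]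
  swap
  · exact mul_nonneg (by positivity) (inv_nonneg.2 (cauchyWeight_pos _).le)
  refine ENNReal.ofReal_le_ofReal ?_
  have h0 := norm_nonneg v
  have h1 : (1 + 2 * Real.pi * ‖v‖) ^ N ≤ (7 * (1 + ‖v‖)) ^ N := by
    refine pow_le_pow_left₀ (by positivity) ?_ N
    nlinarith [Real.pi_lt_d2]
  have h2 : (1 + ‖v‖) ^ (N + 4) ≤ 2 ^ (N + 4) * (1 + ‖v‖ ^ (N + 4)) := by
    have h := add_pow_le zero_le_one h0 (N + 4)
    rw [one_pow] at h
    refine h.trans ?_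
    gcongr
    · norm_num
    · omega
  calc ‖(𝓕 θ) v‖ ^ 2 * (cauchyWeight v.ofLp)⁻¹ * (1 + 2 * Real.pi * ‖v‖) ^ N
      ≤ (M * ‖(𝓕 θ) v‖) * (1 + ‖v‖) ^ 4 * (7 * (1 + ‖v‖)) ^ N := by
        refine mul_le_mul (mul_le_mul ?_ (inv_cauchyWeight_le v)
          (inv_nonneg.2 (cauchyWeight_pos _).le) (by positivity)) h1 (by positivity) (by positivity)
        rw [sq]
        exact mul_le_mul_of_nonneg_right (hM v) (norm_nonneg _)
    _ = (M * 7 ^ N) * ‖(𝓕 θ) v‖ * (1 + ‖v‖) ^ (N + 4) := by rw [mul_pow]; ring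
    _ ≤ (M * 7 ^ N) * ‖(𝓕 θ) v‖ * (2 ^ (N + 4) * (1 + ‖v‖ ^ (N + 4))) := by gcongr
    _ = _ := by ring

/-- The square function over the lattice blocks is dominated pointwise by an average of the
square of the original Fourier integral over the dual scale. -/
lemma exists_tsum_localized_sq_le (θ : 𝓢(Plane, ℂ)) : ∃ B : ℝ≥0∞, B ≠ ⊤ ∧
    ∀ f : Plane → ℂ, Integrable f → ∀ (R : ℝ) (x : Plane),
      ∑' j : Fin 2 → ℤ, ‖fourierInt (fun η => θ (R • η - latticePt j) * f η) x‖ₑ ^ 2 ≤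
        B * ∫⁻ v, cutoffWeight θ v * ‖fourierInt f (x + (2 * Real.pi * R) • v)‖ₑ ^ 2 := by
  obtain ⟨B, hB, h⟩ := exists_bessel_const_plane
  refine ⟨B, hB, fun f hf R x => ?_⟩
  have hc : Continuous fun v => fourierInt f (x + (2 * Real.pi * R) • v) :=
    (continuous_fourierInt hf).comp (by fun_prop)
  have hp : Integrable fun v => (𝓕 θ) v * fourierInt f (x + (2 * Real.pi * R) • v) :=
    (𝓕 θ).integrable.mul_bdd hc.aestronglyMeasurable
      (Eventually.of_forall fun v => norm_fourierInt_le f _)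
  -- Inversion produces the character of frequency `-j`, whereas Bessel is stated for `j`; the
  -- lattice sum is invariant under the reflection.
  rw [← (Equiv.neg (Fin 2 → ℤ)).tsum_eq]
  refine le_of_eq_of_le (tsum_congr fun j => ?_) ((h _ hp).trans_eq ?_)
  · simp only [Equiv.neg_apply]
    rw [fourierInt_localized_eq θ hf, latticePt_neg, neg_neg]
  · simp only [cutoffWeight, enorm_mul, mul_pow]
    congr 2 with v
    ring

/-! ### Averages in weighted spaces -/

lemma stNorm_nonneg (z : SpaceTime) : 0 ≤ stNorm z := Real.sqrt_nonneg _

/-- The product type carries the supremum norm, so this triangle inequality is checked by squaring.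
-/
lemma stNorm_add_le (x u : Plane) (t : ℝ) : stNorm (x + u, t) ≤ stNorm (x, t) + ‖u‖ := by
  have hs : stNorm (x, t) ^ 2 = ‖x‖ ^ 2 + t ^ 2 := Real.sq_sqrt (by positivity)
  have hs0 := stNorm_nonneg (x, t)
  have hx : ‖x‖ ≤ stNorm (x, t) := Real.le_sqrt_of_sq_le (by simpa using sq_nonneg t)
  have hxu := norm_add_le x u
  refine Real.sqrt_le_iff.2 ⟨by positivity, ?_⟩
  have h1 : ‖x + u‖ ^ 2 ≤ (‖x‖ + ‖u‖) ^ 2 := pow_le_pow_left₀ (norm_nonneg _) hxu 2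
  have h2 : ‖x‖ * ‖u‖ ≤ stNorm (x, t) * ‖u‖ := mul_le_mul_of_nonneg_right hx (norm_nonneg u)
  simp only
  nlinarith

/-- An adapted weight varies slowly under spatial translations. -/
lemma IsAdaptedWeight.translate_le {w : SpaceTime → ℝ} {r A : ℝ} {N : ℕ}
    (hw : IsAdaptedWeight w r N A) (hr : 0 < r) (hA : 0 < A) (x u : Plane) (t : ℝ) :
    w (x - u, t) ≤ A ^ 2 * (1 + ‖u‖ / r) ^ N * w (x, t) := by
  have hs0 := stNorm_nonneg (x, t)
  have hs1 := stNorm_nonneg (x - u, t)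
  have h1 : 1 + stNorm (x, t) / r ≤ (1 + ‖u‖ / r) * (1 + stNorm (x - u, t) / r) := by
    have h := stNorm_add_le (x - u) u t
    rw [sub_add_cancel] at h
    have h' : stNorm (x, t) / r ≤ stNorm (x - u, t) / r + ‖u‖ / r := by
      rw [← add_div]; gcongr
    have : 0 ≤ ‖u‖ / r * (stNorm (x - u, t) / r) := by positivity
    linarith
  have h2 : ((1 + stNorm (x - u, t) / r) ^ N)⁻¹ ≤
      (1 + ‖u‖ / r) ^ N * ((1 + stNorm (x, t) / r) ^ N)⁻¹ := by
    rw [← div_eq_mul_inv, le_div_iff₀ (by positivity), inv_mul_le_iff₀ (by positivity), mul_comm,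
      ← mul_pow]
    exact pow_le_pow_left₀ (by positivity) h1 N
  have h3 : ((1 + stNorm (x, t) / r) ^ N)⁻¹ ≤ A * w (x, t) := by
    have := hw.lower (x, t)
    rwa [inv_mul_le_iff₀ hA] at this
  calc w (x - u, t) ≤ A * ((1 + stNorm (x - u, t) / r) ^ N)⁻¹ := hw.upper _
    _ ≤ A * ((1 + ‖u‖ / r) ^ N * (A * w (x, t))) := by gcongr; exact h2.trans (by gcongr)
    _ = _ := by ring

/-- Jensen's inequality for a finite, not normalized, weight. -/
lemma rpow_lintegral_mul_le {X : Type*} [MeasurableSpace X] {μ : Measure X} {V G : X → ℝ≥0∞}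
    (hV : Measurable V) (hG : Measurable G) {p : ℝ} (hp : 1 < p) :
    (∫⁻ x, V x * G x ∂μ) ^ p ≤ (∫⁻ x, V x ∂μ) ^ (p - 1) * ∫⁻ x, V x * G x ^ p ∂μ := by
  have hp0 : 0 < p := by linarith
  have hpq : p.HolderConjugate (p / (p - 1)) := Real.HolderConjugate.conjExponent hp
  -- Hölder against the constant 1 in the measure `V dμ`.
  have h := ENNReal.lintegral_mul_le_Lp_mul_Lq (μ.withDensity V) hpq hG.aemeasurable
    (aemeasurable_const (b := (1 : ℝ≥0∞)))
  simp only [Pi.mul_apply, mul_one, ENNReal.one_rpow] at h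
  rw [lintegral_withDensity_eq_lintegral_mul _ hV hG,
    lintegral_withDensity_eq_lintegral_mul _ hV (hG.pow_const p),
    lintegral_withDensity_eq_lintegral_mul _ hV measurable_const] at h
  simp only [Pi.mul_apply, mul_one] at h
  refine (ENNReal.rpow_le_rpow h hp0.le).trans_eq ?_
  rw [ENNReal.mul_rpow_of_nonneg _ _ hp0.le, ← ENNReal.rpow_mul, ← ENNReal.rpow_mul, mul_comm]
  have e : 1 / (p / (p - 1)) * p = p - 1 := by field_simp
  rw [e, one_div, inv_mul_cancel₀ hp0.ne', ENNReal.rpow_one]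

/-- Averages over spatial translates are bounded on `L^p(w)` as soon as `w` is changed by the
translations only by a factor integrable against the averaging weight. -/
lemma lintegral_rpow_average_mul_le {V : Plane → ℝ≥0∞} (hV : Measurable V)
    {G : SpaceTime → ℝ≥0∞} (hG : Measurable G) {w : SpaceTime → ℝ≥0∞} (hw : Measurable w)
    {m : Plane → ℝ≥0∞} (hmm : Measurable m) (s : ℝ)
    (hm : ∀ (v x : Plane) (t : ℝ), w (x - s • v, t) ≤ m v * w (x, t)) {p : ℝ} (hp : 1 < p) :
    ∫⁻ z : SpaceTime, (∫⁻ v, V v * G (z.1 + s • v, z.2)) ^ p * w z ≤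
      (∫⁻ v, V v) ^ (p - 1) * ((∫⁻ v, V v * m v) * ∫⁻ z, G z ^ p * w z) := by
  have hGv : ∀ z : SpaceTime, Measurable fun v : Plane => G (z.1 + s • v, z.2) := fun z =>
    hG.comp (by fun_prop)
  have hjoint : Measurable fun q : SpaceTime × Plane =>
      V q.2 * G (q.1.1 + s • q.2, q.1.2) ^ p * w q.1 := by
    have h1 : Measurable fun q : SpaceTime × Plane => G (q.1.1 + s • q.2, q.1.2) :=
      hG.comp (by fun_prop)
    exact ((hV.comp measurable_snd).mul (h1.pow_const p)).mul (hw.comp measurable_fst)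
  -- A change of variables moves the translation from `G` onto the weight, where `hm` applies.
  have htr : ∀ v : Plane, ∫⁻ z : SpaceTime, G (z.1 + s • v, z.2) ^ p * w z ≤
      m v * ∫⁻ z, G z ^ p * w z := fun v => by
    have hmp : MeasurePreserving (Prod.map (fun x : Plane => x + s • v) (id : ℝ → ℝ))
        (volume : Measure SpaceTime) volume :=
      (measurePreserving_add_right (volume : Measure Plane) (s • v)).prod
        (MeasurePreserving.id (volume : Measure ℝ))
    have he : MeasurableEmbedding (Prod.map (fun x : Plane => x + s • v) (id : ℝ → ℝ)) :=
      (measurableEmbedding_addRight (s • v)).prodMap MeasurableEmbedding.id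
    have h1 : ∫⁻ z : SpaceTime, G (z.1 + s • v, z.2) ^ p * w z =
        ∫⁻ z : SpaceTime, G z ^ p * w (z.1 - s • v, z.2) := by
      rw [← hmp.lintegral_comp_emb he fun z : SpaceTime => G z ^ p * w (z.1 - s • v, z.2)]
      exact lintegral_congr fun z => by simp [Prod.map]
    have hGw : Measurable fun z => G z ^ p * w z := (hG.pow_const p).mul hw
    rw [h1, ← lintegral_const_mul _ hGw]
    refine lintegral_mono fun z => ?_
    calc G z ^ p * w (z.1 - s • v, z.2) ≤ G z ^ p * (m v * w z) := by
          gcongr; exact hm v z.1 z.2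
      _ = m v * (G z ^ p * w z) := by ring
  calc ∫⁻ z : SpaceTime, (∫⁻ v, V v * G (z.1 + s • v, z.2)) ^ p * w z
      ≤ ∫⁻ z : SpaceTime, (∫⁻ v, V v) ^ (p - 1) *
          ∫⁻ v, V v * G (z.1 + s • v, z.2) ^ p * w z := by
        refine lintegral_mono fun z => ?_
        have hVG : Measurable fun v => V v * G (z.1 + s • v, z.2) ^ p :=
          hV.mul ((hGv z).pow_const p)
        rw [lintegral_mul_const _ hVG, ← mul_assoc]
        gcongr
        exact rpow_lintegral_mul_le hV (hGv z) hp
    _ = (∫⁻ v, V v) ^ (p - 1) *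
          ∫⁻ v, ∫⁻ z : SpaceTime, V v * G (z.1 + s • v, z.2) ^ p * w z := by
        rw [lintegral_const_mul _ hjoint.lintegral_prod_right', lintegral_lintegral_swap
          hjoint.aemeasurable]
    _ ≤ (∫⁻ v, V v) ^ (p - 1) * ∫⁻ v, V v * m v * ∫⁻ z, G z ^ p * w z := by
        gcongr with v
        simp_rw [mul_assoc (V v)]
        rw [lintegral_const_mul]
        · gcongr
          exact htr v
        · have h1 : Measurable fun z : SpaceTime => G (z.1 + s • v, z.2) := hG.comp (by fun_prop)
          exact (h1.pow_const p).mul hw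
    _ = _ := by
        have hVm : Measurable fun v => V v * m v := hV.mul hmm
        rw [lintegral_mul_const _ hVm]

/-! ### Extension operators -/

/-- This permits replacing `h`, meaningful only on the image of `Υ_z`, by a globally measurable
function. -/
lemma extension_congr {h h' : Plane → ℝ} {b : Plane → ℂ} (hh : ∀ η, b η ≠ 0 → h η = h' η)
    (g : Plane → ℂ) : extension h b g = extension h' b g := by
  funext z
  refine integral_congr_ae (Eventually.of_forall fun η => ?_)
  rcases eq_or_ne (b η) 0 with hb | hb
  · simp [hb]
  · simp [hh η hb]

lemma extension_eq_fourierInt (h : Plane → ℝ) (b g : Plane → ℂ) (x : Plane) (t : ℝ) :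
    extension h b g (x, t) =
      fourierInt (fun η => Complex.exp (Complex.I * ((t * h η : ℝ) : ℂ)) * (b η * g η)) x := by
  refine integral_congr_ae (Eventually.of_forall fun η => ?_)
  simp only [Complex.ofReal_add, mul_add, Complex.exp_add]
  ring

lemma integrable_modulated {h : Plane → ℝ} (hh : Measurable h) {f : Plane → ℂ}
    (hf : Integrable f) (t : ℝ) :
    Integrable fun η => Complex.exp (Complex.I * ((t * h η : ℝ) : ℂ)) * f η :=
  hf.bdd_mul (c := 1) (Measurable.aestronglyMeasurable (by fun_prop))
    (Eventually.of_forall fun _ => (norm_exp_I_mul_ofReal _).le)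

lemma continuous_extension {h : Plane → ℝ} (hh : Measurable h) {b g : Plane → ℂ}
    (hf : Integrable fun η => b η * g η) : Continuous (extension h b g) := by
  have e : extension h b g = fun z : SpaceTime => ∫ η,
      Complex.exp (Complex.I * ((inner ℝ z.1 η + z.2 * h η : ℝ) : ℂ)) * (b η * g η) := by
    funext z
    simp only [extension, mul_assoc]
  rw [e]
  refine continuous_of_dominated (bound := fun η => ‖b η * g η‖) (fun z => ?_) (fun z => ?_)
    hf.norm ?_
  · exact (Measurable.aestronglyMeasurable (by fun_prop)).mul hf.1
  · exact Eventually.of_forall fun η => by rw [norm_mul, norm_exp_I_mul_ofReal, one_mul]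
  · exact Eventually.of_forall fun η => by fun_prop

lemma exists_tsum_extension_sq_le (θ : 𝓢(Plane, ℂ)) : ∃ B : ℝ≥0∞, B ≠ ⊤ ∧
    ∀ h : Plane → ℝ, Measurable h → ∀ b g : Plane → ℂ, (Integrable fun η => b η * g η) →
    ∀ (R : ℝ) (z : SpaceTime),
      ∑' j : Fin 2 → ℤ, ‖extension h (fun η => θ (R • η - latticePt j) * b η) g z‖ₑ ^ 2 ≤
        B * ∫⁻ v, cutoffWeight θ v *
          ‖extension h b g (z.1 + (2 * Real.pi * R) • v, z.2)‖ₑ ^ 2 := by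
  obtain ⟨B, hB, H⟩ := exists_tsum_localized_sq_le θ
  refine ⟨B, hB, fun h hh b g hf R z => ?_⟩
  refine le_of_eq_of_le (tsum_congr fun j => ?_)
    ((H _ (integrable_modulated hh hf z.2) R z.1).trans_eq ?_)
  · rw [← Prod.mk.eta (p := z), extension_eq_fourierInt]
    congr 3
    funext η
    simp only
    ring
  · simp_rw [extension_eq_fourierInt]

/-! ### The weighted square function estimate -/

lemma squareFun_rpow {ι : Type} (F : ι → SpaceTime → ℂ) (z : SpaceTime) :
    squareFun F z ^ (10 / 3 : ℝ) = (∑' i, ‖F i z‖ₑ ^ 2) ^ (5 / 3 : ℝ) := by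
  rw [squareFun, ← ENNReal.rpow_mul]
  norm_num

/-- Passing from a square function to the square function over lattice blocks of side `R⁻¹` costs,
in `L^{10/3}(w)` for a weight `w` adapted to radius `r = R / q`, a factor `q^{3N/10}`. -/
lemma exists_weightedNorm_blocks_le (θ : 𝓢(Plane, ℂ)) (N : ℕ) {A : ℝ} (hA : 0 < A) :
    ∃ D : ℝ≥0∞, D ≠ ⊤ ∧ ∀ (ι : Type) [Fintype ι] (h : Plane → ℝ), Measurable h →
      ∀ (b : ι → Plane → ℂ) (g : Plane → ℂ), (∀ ν, Integrable fun η => b ν η * g η) →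
      ∀ R r q : ℝ, 0 < R → 0 < r → 1 ≤ q → R / r = q →
      ∀ w : SpaceTime → ℝ, IsAdaptedWeight w r N A →
        weightedNorm w (squareFun fun i : ι × (Fin 2 → ℤ) =>
            extension h (fun η => θ (R • η - latticePt i.2) * b i.1 η) g) ≤
          D * ENNReal.ofReal (q ^ N) ^ (3 / 10 : ℝ) *
            weightedNorm w (squareFun fun ν => extension h (b ν) g) := by
  obtain ⟨B, hB, H⟩ := exists_tsum_extension_sq_le θ
  set V := cutoffWeight θ
  set J := ∫⁻ v, V v * ENNReal.ofReal ((1 + 2 * Real.pi * ‖v‖) ^ N) with hJ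
  have hJt : J ≠ ⊤ := lintegral_cutoffWeight_mul_pow_ne_top θ N
  have hVt : ∫⁻ v, V v ≠ ⊤ := by
    simpa using lintegral_cutoffWeight_mul_pow_ne_top θ 0
  have hV : Measurable V := measurable_cutoffWeight θ
  -- The exponent 5/3 is half of 10/3, because the pointwise bound concerns the squared square
  -- function. The three factors come from Bessel, Jensen and the translated weight, with `q^N` kept
  -- apart.
  set D₀ : ℝ≥0∞ := B ^ (5 / 3 : ℝ) *
    ((∫⁻ v, V v) ^ (5 / 3 - 1 : ℝ) * (ENNReal.ofReal (A ^ 2) * J)) with hD₀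
  have hD₀t : D₀ ≠ ⊤ := by
    refine ENNReal.mul_ne_top (ENNReal.rpow_ne_top_of_nonneg (by norm_num) hB)
      (ENNReal.mul_ne_top (ENNReal.rpow_ne_top_of_nonneg (by norm_num) hVt)
        (ENNReal.mul_ne_top ENNReal.ofReal_ne_top hJt))
  refine ⟨D₀ ^ (3 / 10 : ℝ), ENNReal.rpow_ne_top_of_nonneg (by norm_num) hD₀t, ?_⟩
  intro ι _ h hh b g hf R r q hR hr hq hqr w hw
  let G : SpaceTime → ℝ≥0∞ := fun z => ∑ ν, ‖extension h (b ν) g z‖ₑ ^ 2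
  have hE : ∀ ν, Measurable fun z => ‖extension h (b ν) g z‖ₑ ^ 2 := fun ν =>
    (continuous_extension hh (hf ν)).enorm.measurable.pow_const 2
  have hG : Measurable G := Finset.measurable_fun_sum _ fun ν _ => hE ν
  let s : ℝ := 2 * Real.pi * R
  have hsq : ∀ z : SpaceTime, ∑' i : ι × (Fin 2 → ℤ),
      ‖extension h (fun η => θ (R • η - latticePt i.2) * b i.1 η) g z‖ₑ ^ 2 ≤
        B * ∫⁻ v, V v * G (z.1 + s • v, z.2) := fun z => by
    have hsum : ∫⁻ v, V v * G (z.1 + s • v, z.2) = ∑ ν, ∫⁻ v, V v *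
        ‖extension h (b ν) g (z.1 + s • v, z.2)‖ₑ ^ 2 := by
      simp only [G, Finset.mul_sum]
      refine lintegral_finsetSum _ fun ν _ => hV.mul ?_
      exact (hE ν).comp (g := fun z => ‖extension h (b ν) g z‖ₑ ^ 2) (by fun_prop)
    rw [ENNReal.tsum_prod', tsum_fintype, hsum, Finset.mul_sum]
    exact Finset.sum_le_sum fun ν _ => H h hh (b ν) g (hf ν) R z
  have hwm : ∀ (v x : Plane) (t : ℝ), ENNReal.ofReal (w (x - s • v, t)) ≤
      ENNReal.ofReal (A ^ 2 * q ^ N * (1 + 2 * Real.pi * ‖v‖) ^ N) *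
        ENNReal.ofReal (w (x, t)) := fun v x t => by
    rw [← ENNReal.ofReal_mul (by positivity)]
    refine ENNReal.ofReal_le_ofReal ((hw.translate_le hr hA x (s • v) t).trans ?_)
    have hw0 : 0 ≤ w (x, t) := by
      have := hw.lower (x, t)
      have h0 := stNorm_nonneg (x, t)
      exact le_trans (by positivity) this
    refine mul_le_mul_of_nonneg_right ?_ hw0
    rw [mul_assoc, ← mul_pow]
    have hpi := Real.pi_pos
    -- The hypothesis `1 ≤ q` lets the summand 1 be absorbed, so `q` factors out of the
    -- `v`-integral.
    have e : 1 + ‖s • v‖ / r ≤ q * (1 + 2 * Real.pi * ‖v‖) := by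
      have : ‖s • v‖ / r = q * (2 * Real.pi * ‖v‖) := by
        rw [norm_smul, Real.norm_of_nonneg (by positivity), ← hqr]
        simp only [s]
        ring
      rw [this]
      nlinarith
    gcongr
  have hmm : Measurable fun v : Plane =>
      ENNReal.ofReal (A ^ 2 * q ^ N * (1 + 2 * Real.pi * ‖v‖) ^ N) := by fun_prop
  have hVm : ∫⁻ v, V v * ENNReal.ofReal (A ^ 2 * q ^ N * (1 + 2 * Real.pi * ‖v‖) ^ N) =
      ENNReal.ofReal (A ^ 2) * J * ENNReal.ofReal (q ^ N) := by
    rw [mul_assoc, mul_comm J, ← mul_assoc, ← ENNReal.ofReal_mul (by positivity), hJ,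
      ← lintegral_const_mul' _ _ ENNReal.ofReal_ne_top]
    refine lintegral_congr fun v => ?_
    rw [ENNReal.ofReal_mul (by positivity)]
    ring
  have havg := lintegral_rpow_average_mul_le hV hG hw.measurable.ennreal_ofReal hmm s hwm
    (p := 5 / 3) (by norm_num)
  rw [hVm] at havg
  have hGsq : ∀ z, squareFun (fun ν => extension h (b ν) g) z ^ (10 / 3 : ℝ) =
      G z ^ (5 / 3 : ℝ) := fun z => by
    rw [squareFun_rpow, tsum_fintype]
  unfold weightedNorm
  rw [← ENNReal.mul_rpow_of_nonneg _ _ (by norm_num),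
    ← ENNReal.mul_rpow_of_nonneg _ _ (by norm_num)]
  refine ENNReal.rpow_le_rpow ?_ (by norm_num)
  simp_rw [hGsq, squareFun_rpow]
  calc ∫⁻ z, (∑' i : ι × (Fin 2 → ℤ),
        ‖extension h (fun η => θ (R • η - latticePt i.2) * b i.1 η) g z‖ₑ ^ 2) ^ (5 / 3 : ℝ) *
          ENNReal.ofReal (w z)
      ≤ ∫⁻ z : SpaceTime, B ^ (5 / 3 : ℝ) *
          ((∫⁻ v, V v * G (z.1 + s • v, z.2)) ^ (5 / 3 : ℝ) * ENNReal.ofReal (w z)) := by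
        refine lintegral_mono fun z => ?_
        rw [← mul_assoc, ← ENNReal.mul_rpow_of_nonneg _ _ (by norm_num)]
        gcongr
        exact hsq z
    _ = B ^ (5 / 3 : ℝ) * ∫⁻ z : SpaceTime,
          (∫⁻ v, V v * G (z.1 + s • v, z.2)) ^ (5 / 3 : ℝ) * ENNReal.ofReal (w z) :=
        lintegral_const_mul' _ _ (ENNReal.rpow_ne_top_of_nonneg (by norm_num) hB)
    _ ≤ _ := by
        refine (mul_le_mul_right havg _).trans_eq ?_
        rw [hD₀]
        ring

/-! ### Application to the transported amplitudes -/

/-- The sectorial cutoffs may be singular at the origin, which the ball avoids because `ε₀ < 1`. -/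
lemma IsAngularPartition.continuousOn_mul {lam K : ℝ} {Cχ : ℕ → ℝ} {n : ℕ}
    {κ : Fin (n + 1) → Plane} {χ : Fin (n + 1) → Plane → ℝ}
    (hχ : IsAngularPartition lam K Cχ n κ χ) {a : Plane → ℂ} (ha : Continuous a)
    {ε₀ : ℝ} (hε₀ : ε₀ < 1) (ν : Fin (n + 1)) :
    ContinuousOn (fun η => (χ ν η : ℂ) * a η) (Metric.ball e₂ ε₀) := by
  have h : ContinuousOn (χ ν) (Metric.ball e₂ ε₀) :=
    (hχ.smooth ν).continuousOn.mono fun η hη h0 => zero_notMem_ball hε₀ (by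
      rw [mem_singleton_iff] at h0; rwa [h0] at hη)
  exact (Complex.continuous_ofReal.comp_continuousOn h).mul ha.continuousOn

lemma integrable_mul_of_memLp {b g : Plane → ℂ} (hb : Continuous b) (hbc : HasCompactSupport b)
    {p : ℝ≥0∞} (hp : 1 ≤ p) (hg : MemLp g p) : Integrable fun η => b η * g η := by
  have := (hg.locallyIntegrable hp).integrable_smul_left_of_hasCompactSupport hb hbc
  simpa [smul_eq_mul] using this

end RadialBlocks

end

open RadialBlocks in
theorem lemma5p1
    (ε₀ : ℝ) (hε₀ : 0 < ε₀) (hε₀' : ε₀ < 1)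
    (φ : RadialBlocks.SpaceTime → RadialBlocks.Plane → ℝ) (hφ : RadialBlocks.IsPhase φ ε₀)
    (a₂ : RadialBlocks.Plane → ℂ) (ha₂ : ContDiff ℝ ∞ a₂) (ha₂c : HasCompactSupport a₂)
    (ha₂s : tsupport a₂ ⊆ Metric.ball RadialBlocks.e₂ ε₀)
    (ρ : RadialBlocks.Plane → ℝ) (hρ : RadialBlocks.IsLatticePartition ρ)
    (K : ℝ) (Cχ : ℕ → ℝ) (N : ℕ) (A : ℝ) (hA : 1 ≤ A) (ε : ℝ) (hε : 0 < ε) :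
    ∃ (C : ℝ) (rapDec : ℝ → ℝ), RadialBlocks.IsRapDec rapDec ∧
      ∀ lam : ℝ, 1 ≤ lam →
      ∀ (n : ℕ) (κ : Fin (n + 1) → RadialBlocks.Plane)
        (χ : Fin (n + 1) → RadialBlocks.Plane → ℝ),
        RadialBlocks.IsAngularPartition lam K Cχ n κ χ →
      ∀ zc : RadialBlocks.SpaceTime, lam⁻¹ • zc ∈ RadialBlocks.stBall ε₀ →
      ∀ w : RadialBlocks.SpaceTime → ℝ,
        RadialBlocks.IsAdaptedWeight w (lam ^ (1 / 2 - ε)) N A →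
      ∀ g : RadialBlocks.Plane → ℂ, MemLp g (10 / 3) volume →
        RadialBlocks.weightedNorm w (RadialBlocks.squareFun
            (fun i : Fin (n + 1) × (Fin 2 → ℤ) =>
              RadialBlocks.extBlock φ ε₀ lam ε zc a₂ ρ (χ i.1) i.2 g))
          ≤ ENNReal.ofReal (C * lam ^ (3 / 20 * (N : ℝ) * ε)) *
              RadialBlocks.weightedNorm w (RadialBlocks.squareFun
                (fun ν : Fin (n + 1) => RadialBlocks.extAngular φ ε₀ lam zc a₂ (χ ν) g))
            + ENNReal.ofReal (rapDec lam) * eLpNorm g (10 / 3) volume := by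
  have hρc : HasCompactSupport fun η => (ρ η : ℂ) := hρ.compact.comp_left Complex.ofReal_zero
  let θ : SchwartzMap Plane ℂ :=
    hρc.toSchwartzMap (Complex.ofRealCLM.contDiff.comp hρ.smooth)
  obtain ⟨D, hD, H⟩ := exists_weightedNorm_blocks_le θ N (zero_lt_one.trans_le hA)
  -- The kernels of the block projections are handled exactly, so no remainder term arises.
  refine ⟨D.toReal, fun _ => 0, fun M => ⟨0, fun _ _ => by simp⟩, ?_⟩
  intro lam hlam n κ χ hχ zc hzc w hw g hg
  have hlam0 : 0 < lam := zero_lt_one.trans_le hlam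
  set b : Fin (n + 1) → Plane → ℂ := fun ν => ampAngular φ ε₀ lam zc a₂ (χ ν)
  set U := gradImage φ ε₀ (lam⁻¹ • zc)
  have hUo : IsOpen U := hφ.isOpen_gradImage hzc
  -- Off `U` the values of `hFun` depend on the arbitrary choice in `psi`. Cutting to the open set
  -- `U`, where it is continuous, gives measurability without changing the operators.
  set h := U.indicator (hFun φ ε₀ lam zc) with hh
  have hhm : Measurable h := by
    classical
    have : Measurable (U.piecewise (hFun φ ε₀ lam zc) 0) :=
      (hφ.continuousOn_hFun hzc).measurable_piecewise continuousOn_const hUo.measurableSet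
    rwa [piecewise_eq_indicator] at this
  have hbU : ∀ ν η, b ν η ≠ 0 → hFun φ ε₀ lam zc η = h η := fun ν η hne => by
    have hη : η ∈ U := by
      by_contra hη
      exact hne (if_neg hη)
    rw [hh, indicator_of_mem hη]
  have hzero : ∀ ν, ∀ η ∉ tsupport a₂, (χ ν η : ℂ) * a₂ η = 0 := fun ν η hη => by
    rw [image_eq_zero_of_notMem_tsupport hη, mul_zero]
  have hp : (1 : ℝ≥0∞) ≤ 10 / 3 := by
    rw [ENNReal.le_div_iff_mul_le (by simp) (by simp)]
    norm_num
  have hint : ∀ ν, Integrable fun η => b ν η * g η := fun ν =>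
    integrable_mul_of_memLp
      (hφ.continuous_transported hzc (hχ.continuousOn_mul ha₂.continuous hε₀' ν) ha₂c ha₂s
        (hzero ν))
      (hφ.hasCompactSupport_transported hzc ha₂c ha₂s (hzero ν)) hp hg
  have hang : ∀ ν, extAngular φ ε₀ lam zc a₂ (χ ν) g = extension h (b ν) g := fun ν =>
    extension_congr (hbU ν) g
  have hblk : ∀ i : Fin (n + 1) × (Fin 2 → ℤ), extBlock φ ε₀ lam ε zc a₂ ρ (χ i.1) i.2 g =
      extension h (fun η => θ (lam ^ (1 / 2 - ε / 2) • η - latticePt i.2) * b i.1 η) g :=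
    fun i => extension_congr (fun η hne => hbU i.1 η (right_ne_zero_of_mul hne)) g
  -- The ratio of the averaging scale to the weight's radius is the sole source of loss: its power
  -- `3N/10` is `lam ^ (3Nε/20)`.
  have hq : lam ^ (1 / 2 - ε / 2) / lam ^ (1 / 2 - ε) = lam ^ (ε / 2) := by
    rw [← Real.rpow_sub hlam0]; ring_nf
  have key := H (Fin (n + 1)) h hhm b g hint (lam ^ (1 / 2 - ε / 2)) (lam ^ (1 / 2 - ε))
    (lam ^ (ε / 2)) (by positivity) (by positivity) (Real.one_le_rpow hlam (by positivity)) hq w hw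
  simp_rw [hang, hblk]
  refine (key.trans_eq ?_).trans le_self_add
  congr 1
  rw [ENNReal.ofReal_mul ENNReal.toReal_nonneg, ENNReal.ofReal_toReal hD,
    ENNReal.ofReal_rpow_of_nonneg (by positivity) (by norm_num), ← Real.rpow_natCast,
    ← Real.rpow_mul hlam0.le, ← Real.rpow_mul hlam0.le]
  congr 3
  ring
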